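/- Let $A$ be a (not necessarily unital) C*-algebra and let $H$ be a full Hilbert bimodule over $A$: a right Hilbert $A$-module, with $A$-valued inner product linear in the second variable, together with a $*$-homomorphism $\varphi:A\to\mathcal L(H)$ into the adjointable operators, such that the inner products $\langle\xi,\eta\rangle$ span a dense subspace of $A$. Let $\mathcal K(H)$ be the closed linear span of the operators $\theta_{\xi,\eta}(\zeta)=\xi\langle\eta,\zeta\rangle$. A Toeplitz representation of $H$ in a C*-algebra $C$ is a pair $(\tau,\pi)$, with $\tau:H\to C$ linear and $\pi:A\to C$ a $*$-homomorphism, such that $\tau(\xi a)=\tau(\xi)\pi(a)$, $\tau(\xi)^*\tau(\eta)=\pi(\langle\xi,\eta\rangle)$ and $\tau(\varphi(a)\xi)=\pi(a)\tau(\xi)$. Let $\psi:\mathcal K(H)\to C$ be the induced homomorphism with $\psi(\theta_{\xi,\eta})=\tau(\xi)\tau(\eta)^*$; the pair is covariant if $\pi(a)=\psi(\varphi(a))$ for all $a\in I_H=\varphi^{-1}(\mathcal K(H))\cap(\ker\varphi)^\perp$, where $(\ker\varphi)^\perp=\{a\in A: ab=0\text{ for all }b\in\ker\varphi\}$. The Cuntz–Pimsner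 algebra $\mathcal O_H$ is the C*-algebra generated by a universal covariant representation, and its core $\mathcal F_H$ is the fixed point algebra of the gauge action of $\mathbb T$ on $\mathcal O_H$, which is determined by $\tau(\xi)\mapsto z\,\tau(\xi)$ and $\pi(a)\mapsto\pi(a)$ for $z\in\mathbb T$. Assume that $H$ has a finite basis $\xi_1,\dots,\xi_n$, in the sense that $\xi=\sum_{i=1}^n\xi_i\langle\xi_i,\xi\rangle$ for all $\xi\in H$. Let $S_i$ be the image of $\xi_i$ in $\mathcal O_H$, write $a$ also for the image of $a\in A$ in $\mathcal O_H$, and for a word $\alpha=\alpha_1\cdots\alpha_k\in\{1,\dots,n\}^k$, $k\ge 0$, put $|\alpha|=k$ and $S_\alpha=S_{\alpha_1}\cdots S_{\alpha_k}$ (for $k=0$ the factor is omitted). Then: 1. $\mathcal K(H)=\mathcal L(H)$; 2. $\mathcal O_H$ is the closed linear span of the monomials $S_\alpha aS_\beta^*$, where $\alpha,\beta$ are arbitrary words and $a\in A$; 3. $\mathcal F_H$ is the closed linear span of the monomials $S_\alpha aS_\beta^*$ with $a\in A$ and $|\alpha|=|\beta|$. -/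

import Mathlib

open scoped ENNReal

universe u v w

noncomputable section

namespace CP

/-! ### Right Hilbert modules

A right Hilbert `A`-module is a complete `CStarModule Aᵐᵒᵖ H`: the right multiplication `x a` is
`MulOpposite.op a • x`, and the `A`-valued inner product, conjugate linear in the first and linear
in the second variable, is `rinner A x y`. It satisfies `⟨x, y a⟩ = ⟨x, y⟩ a`. -/

section Module

variable (A : Type u) {H : Type v} [NonUnitalCStarAlgebra A] [PartialOrder A]
  [NormedAddCommGroup H] [NormedSpace ℂ H] [SMul Aᵐᵒᵖ H] [CStarModule Aᵐᵒᵖ H]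

/-- The `A`-valued inner product `⟨x, y⟩` of a right Hilbert `A`-module. -/
def rinner (x y : H) : A := MulOpposite.unop (inner Aᵐᵒᵖ x y)

theorem rinner_add_right (x y z : H) : rinner A x (y + z) = rinner A x y + rinner A x z := by
  simp [rinner]

theorem rinner_add_left (x y z : H) : rinner A (x + y) z = rinner A x z + rinner A y z := by
  simp [rinner]

theorem rinner_smul_right (c : ℂ) (x y : H) : rinner A x (c • y) = c • rinner A x y := by
  simp [rinner]

theorem rinner_smul_left (c : ℂ) (x y : H) : rinner A (c • x) y = star c • rinner A x y := by
  simp [rinner]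

theorem rinner_op_smul_right (a : A) (x y : H) :
    rinner A x (MulOpposite.op a • y) = rinner A x y * a := by
  simp [rinner]

theorem star_rinner (x y : H) : star (rinner A x y) = rinner A y x := by
  rw [rinner, rinner, ← CStarModule.star_inner x y, MulOpposite.unop_star]

theorem norm_rinner_self (x : H) : ‖rinner A x x‖ = ‖x‖ ^ 2 := by
  rw [CStarModule.norm_sq_eq Aᵐᵒᵖ]; rfl

/-- `H` is full: the inner products span a dense subspace of `A`. -/
def IsFull (H : Type v) [NormedAddCommGroup H] [NormedSpace ℂ H] [SMul Aᵐᵒᵖ H]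
    [CStarModule Aᵐᵒᵖ H] : Prop :=
  (Submodule.span ℂ {a : A | ∃ x y : H, a = rinner A x y}).topologicalClosure = ⊤

/-- A (finite) basis of `H`: every `x` in `H` equals `∑ i, ξ i ⟨ξ i, x⟩`. -/
def IsBasis {n : ℕ} (ξ : Fin n → H) : Prop :=
  ∀ x : H, x = ∑ i, MulOpposite.op (rinner A (ξ i) x) • ξ i

/-- The algebra `L(H)` of all adjointable operators on `H`. -/
def adjointable (H : Type v) [NormedAddCommGroup H] [NormedSpace ℂ H] [SMul Aᵐᵒᵖ H]
    [CStarModule Aᵐᵒᵖ H] : Subalgebra ℂ (H →L[ℂ] H) where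
  carrier := {T | ∃ S : H →L[ℂ] H, ∀ x y, rinner A (T x) y = rinner A x (S y)}
  mul_mem' := by
    rintro T₁ T₂ ⟨S₁, h₁⟩ ⟨S₂, h₂⟩
    exact ⟨S₂ * S₁, fun x y => by simp [h₁, h₂]⟩
  add_mem' := by
    rintro T₁ T₂ ⟨S₁, h₁⟩ ⟨S₂, h₂⟩
    exact ⟨S₁ + S₂, fun x y => by simp [h₁, h₂, rinner_add_left, rinner_add_right]⟩
  algebraMap_mem' c :=
    ⟨algebraMap ℂ _ (star c), fun x y => by
      simp [Algebra.algebraMap_eq_smul_one, rinner_smul_left, rinner_smul_right]⟩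

theorem starOrderedRing_op [StarOrderedRing A] : StarOrderedRing Aᵐᵒᵖ := by
  refine StarOrderedRing.of_nonneg_iff' (fun {x y} h z => ?_) (fun x => ?_)
  · exact add_le_add_right (α := A) h (MulOpposite.unop z)
  · constructor
    · intro h
      obtain ⟨s, hs⟩ := CStarAlgebra.nonneg_iff_eq_star_mul_self.mp
        (show (0 : A) ≤ MulOpposite.unop x from h)
      exact ⟨MulOpposite.op (star s), MulOpposite.unop_injective (by simpa using hs)⟩
    · rintro ⟨s, rfl⟩
      exact mul_star_self_nonneg (MulOpposite.unop s)

theorem rinner_ext {x y : H} (h : ∀ z : H, rinner A z x = rinner A z y) : x = y := by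
  have h' : ∀ z : H, inner Aᵐᵒᵖ z (x - y) = 0 := fun z => by
    have := congrArg MulOpposite.op (h z)
    simp only [rinner, MulOpposite.op_unop] at this
    rw [CStarModule.inner_sub_right, this, sub_self]
  exact sub_eq_zero.mp (CStarModule.inner_self.mp (h' (x - y)))

theorem norm_rinner_le [StarOrderedRing A] (x y : H) : ‖rinner A x y‖ ≤ ‖x‖ * ‖y‖ := by
  have := starOrderedRing_op A
  exact CStarModule.norm_inner_le (A := Aᵐᵒᵖ) H (x := x) (y := y)

theorem norm_op_smul_le (x : H) (a : A) : ‖MulOpposite.op a • x‖ ≤ ‖x‖ * ‖a‖ := by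
  refine (sq_le_sq₀ (norm_nonneg _) (by positivity)).mp ?_
  rw [← norm_rinner_self A, rinner_op_smul_right, ← star_rinner, rinner_op_smul_right, star_mul]
  calc ‖star a * star (rinner A x x) * a‖ ≤ ‖star a‖ * ‖star (rinner A x x)‖ * ‖a‖ :=
        (norm_mul_le _ _).trans (by gcongr; exact norm_mul_le _ _)
    _ = (‖x‖ * ‖a‖) ^ 2 := by rw [norm_star, norm_star, norm_rinner_self]; ring

/-- The rank one operator `θ_{x,y} : z ↦ x ⟨y, z⟩`. -/
def rankOne [StarOrderedRing A] (x y : H) : H →L[ℂ] H :=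
  LinearMap.mkContinuous
    { toFun := fun z => MulOpposite.op (rinner A y z) • x
      map_add' := fun z z' => rinner_ext A fun t => by
        simp only [rinner_op_smul_right, rinner_add_right, mul_add]
      map_smul' := fun c z => rinner_ext A fun t => by
        simp only [rinner_op_smul_right, rinner_smul_right, mul_smul_comm, RingHom.id_apply] }
    (‖x‖ * ‖y‖) fun z => by
      refine (norm_op_smul_le A x _).trans ?_
      rw [mul_assoc]
      gcongr
      exact norm_rinner_le A y z

/-- The space `K(H)` of compact operators: the closed linear span of the rank one operators. -/
def compacts [StarOrderedRing A] (H : Type v) [NormedAddCommGroup H] [NormedSpace ℂ H]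
    [SMul Aᵐᵒᵖ H] [CStarModule Aᵐᵒᵖ H] : Submodule ℂ (H →L[ℂ] H) :=
  (Submodule.span ℂ {T | ∃ x y : H, T = rankOne A x y}).topologicalClosure

theorem rankOne_mem_compacts [StarOrderedRing A] (x y : H) : rankOne A x y ∈ compacts A H :=
  Submodule.le_topologicalClosure _ (Submodule.subset_span ⟨x, y, rfl⟩)

end Module

/-! ### Hilbert bimodules and their representations -/

/-- The structure of a Hilbert bimodule (C*-correspondence) on a right Hilbert `A`-module `H`:
a `*`-homomorphism `φ` from `A` to the adjointable operators; `φ (star a)` is the adjoint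
of `φ a`. -/
structure HilbertBimodule (A : Type u) (H : Type v) [NonUnitalCStarAlgebra A] [PartialOrder A]
    [NormedAddCommGroup H] [NormedSpace ℂ H] [SMul Aᵐᵒᵖ H] [CStarModule Aᵐᵒᵖ H] where
  φ : A →ₙₐ[ℂ] (H →L[ℂ] H)
  adjoint_φ : ∀ (a : A) (x y : H), rinner A (φ a x) y = rinner A x (φ (star a) y)

theorem HilbertBimodule.φ_mem_adjointable {A : Type u} {H : Type v} [NonUnitalCStarAlgebra A]
    [PartialOrder A] [NormedAddCommGroup H] [NormedSpace ℂ H] [SMul Aᵐᵒᵖ H]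
    [CStarModule Aᵐᵒᵖ H] (X : HilbertBimodule A H) (a : A) :
    X.φ a ∈ adjointable A H :=
  ⟨X.φ (star a), X.adjoint_φ a⟩

section Rep

variable {A : Type u} {H : Type v} [NonUnitalCStarAlgebra A] [PartialOrder A] [StarOrderedRing A]
  [NormedAddCommGroup H] [NormedSpace ℂ H] [SMul Aᵐᵒᵖ H] [CStarModule Aᵐᵒᵖ H]

/-- Membership in the ideal `I_H = φ⁻¹(K(H)) ∩ (ker φ)^⊥` of `A`. -/
def HilbertBimodule.MemIdeal (X : HilbertBimodule A H) (a : A) : Prop :=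
  X.φ a ∈ compacts A H ∧ ∀ b, X.φ b = 0 → a * b = 0

/-- `(τ, π)` is a Toeplitz representation of the Hilbert bimodule in the C*-algebra `C`. -/
structure IsToeplitz (X : HilbertBimodule A H) {C : Type w} [NonUnitalCStarAlgebra C]
    (τ : H →ₗ[ℂ] C) (π : A →⋆ₙₐ[ℂ] C) : Prop where
  map_right : ∀ (x : H) (a : A), τ (MulOpposite.op a • x) = τ x * π a
  map_inner : ∀ x y : H, star (τ x) * τ y = π (rinner A x y)
  map_left : ∀ (a : A) (x : H), τ (X.φ a x) = π a * τ x

/-- `(τ, π)` is a Cuntz–Pimsner covariant representation in `C`: a Toeplitz representation such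
that `π a = ψ (φ a)` for `a ∈ I_H`, where `ψ : K(H) → C` is the map with
`ψ (θ_{x,y}) = τ x * star (τ y)`. (A continuous linear `ψ` with these values is unique, since the
`θ_{x,y}` span a dense subspace of `K(H)`; it is the homomorphism defined by `τ`.) -/
structure IsCovariant (X : HilbertBimodule A H) {C : Type w} [NonUnitalCStarAlgebra C]
    (τ : H →ₗ[ℂ] C) (π : A →⋆ₙₐ[ℂ] C) : Prop extends IsToeplitz X τ π where
  covariant : ∃ ψ : compacts A H →L[ℂ] C,
    (∀ x y : H, ψ ⟨rankOne A x y, rankOne_mem_compacts A x y⟩ = τ x * star (τ y)) ∧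
    ∀ (a : A) (ha : X.MemIdeal a), π a = ψ ⟨X.φ a, ha.1⟩

/-- All covariant representations in C*-algebras in a universe containing `A` and `H`. Every
covariant representation in any C*-algebra generates a C*-algebra isomorphic to one in this
universe. -/
structure CovRep (X : HilbertBimodule A H) : Type (max u v + 1) where
  C : Type (max u v)
  [cstar : NonUnitalCStarAlgebra C]
  τ : H →ₗ[ℂ] C
  π : A →⋆ₙₐ[ℂ] C
  isCovariant : IsCovariant X τ π

instance (X : HilbertBimodule A H) (i : CovRep X) : NonUnitalCStarAlgebra i.C := i.cstar

theorem IsToeplitz.norm_τ_le {X : HilbertBimodule A H} {C : Type w} [NonUnitalCStarAlgebra C]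
    {τ : H →ₗ[ℂ] C} {π : A →⋆ₙₐ[ℂ] C} (h : IsToeplitz X τ π) (x : H) : ‖τ x‖ ≤ ‖x‖ := by
  refine (sq_le_sq₀ (norm_nonneg _) (norm_nonneg _)).mp ?_
  rw [sq, ← CStarRing.norm_star_mul_self, h.map_inner, ← norm_rinner_self A]
  exact NonUnitalStarAlgHom.norm_apply_le π _

theorem IsCovariant.rotate {X : HilbertBimodule A H} {C : Type w} [NonUnitalCStarAlgebra C]
    {τ : H →ₗ[ℂ] C} {π : A →⋆ₙₐ[ℂ] C} (h : IsCovariant X τ π) (z : Circle) :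
    IsCovariant X ((z : ℂ) • τ) π := by
  have hz : (starRingEnd ℂ) (z : ℂ) * (z : ℂ) = 1 := by
    rw [mul_comm, Complex.mul_conj, Circle.normSq_coe, Complex.ofReal_one]
  obtain ⟨ψ, h₁, h₂⟩ := h.covariant
  exact
    { map_right := fun x a => by simp [h.map_right, smul_mul_assoc]
      map_inner := fun x y => by
        simp [← h.map_inner, smul_mul_assoc, mul_smul_comm, smul_smul, mul_comm (z : ℂ), hz]
      map_left := fun a x => by simp [h.map_left, mul_smul_comm]
      covariant := ⟨ψ, fun x y => by
        simp [h₁, smul_mul_assoc, mul_smul_comm, smul_smul, hz], h₂⟩ }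

/-- For a scalar `z` of modulus one, `(z τ, π)` is again a covariant representation. -/
def CovRep.rotate {X : HilbertBimodule A H} (z : Circle) (i : CovRep X) : CovRep X where
  C := i.C
  τ := (z : ℂ) • i.τ
  π := i.π
  isCovariant := i.isCovariant.rotate z

/-! ### The Cuntz–Pimsner algebra

It is built as the C*-algebra generated by the direct sum of all covariant representations, inside
the C*-algebra of bounded families. -/

/-- The C*-algebra of bounded families `(c_i)` indexed by the covariant representations. -/
abbrev Big (X : HilbertBimodule A H) : Type (max u v + 1) := lp (fun i : CovRep X => i.C) ∞

/-- The direct sum of the `τ` of all covariant representations. -/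
def bigτ (X : HilbertBimodule A H) : H →ₗ[ℂ] Big X where
  toFun x := ⟨fun i => i.τ x, memℓp_infty ⟨‖x‖, by
    rintro _ ⟨i, rfl⟩
    exact i.isCovariant.norm_τ_le x⟩⟩
  map_add' x y := by ext i; exact map_add i.τ x y
  map_smul' c x := by ext i; exact map_smul i.τ c x

/-- The direct sum of the `π` of all covariant representations. -/
def bigπ (X : HilbertBimodule A H) : A →⋆ₙₐ[ℂ] Big X where
  toFun a := ⟨fun i => i.π a, memℓp_infty ⟨‖a‖, by
    rintro _ ⟨i, rfl⟩
    exact NonUnitalStarAlgHom.norm_apply_le i.π a⟩⟩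
  map_smul' c a := by ext i; exact map_smul i.π c a
  map_zero' := by ext i; exact map_zero i.π
  map_add' a b := by ext i; exact map_add i.π a b
  map_mul' a b := by ext i; exact map_mul i.π a b
  map_star' a := by ext i; exact map_star i.π a

/-- The gauge automorphism on bounded families. -/
def bigGauge (X : HilbertBimodule A H) (z : Circle) : Big X →⋆ₙₐ[ℂ] Big X where
  toFun c := ⟨fun i => c (i.rotate z), memℓp_infty ⟨‖c‖, by
    rintro _ ⟨i, rfl⟩
    exact lp.norm_apply_le_norm ENNReal.top_ne_zero c (i.rotate z)⟩⟩
  map_smul' _ _ := rfl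
  map_zero' := rfl
  map_add' _ _ := rfl
  map_mul' _ _ := rfl
  map_star' _ := rfl

/-- The C*-subalgebra of `Big X` generated by the images of `H` and `A`. -/
def cpSub (X : HilbertBimodule A H) : NonUnitalStarSubalgebra ℂ (Big X) :=
  (NonUnitalStarAlgebra.adjoin ℂ
    (Set.range (bigτ X) ∪ Set.range (bigπ X))).topologicalClosure

/-- The Cuntz–Pimsner algebra `O_H`. -/
abbrev CuntzPimsner (X : HilbertBimodule A H) : Type (max u v + 1) := cpSub X

instance (X : HilbertBimodule A H) : NonUnitalCStarAlgebra (CuntzPimsner X) :=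
  NonUnitalStarSubalgebra.nonUnitalCStarAlgebra (cpSub X)
    (h_closed := NonUnitalStarSubalgebra.isClosed_topologicalClosure _)

theorem bigτ_mem (X : HilbertBimodule A H) (x : H) : bigτ X x ∈ cpSub X :=
  NonUnitalStarSubalgebra.le_topologicalClosure _
    (NonUnitalStarAlgebra.subset_adjoin ℂ _ (Or.inl ⟨x, rfl⟩))

theorem bigπ_mem (X : HilbertBimodule A H) (a : A) : bigπ X a ∈ cpSub X :=
  NonUnitalStarSubalgebra.le_topologicalClosure _
    (NonUnitalStarAlgebra.subset_adjoin ℂ _ (Or.inr ⟨a, rfl⟩))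

/-- The canonical map `x ↦ S_x` from `H` to `O_H`. -/
def cpτ (X : HilbertBimodule A H) : H →ₗ[ℂ] CuntzPimsner X where
  toFun x := ⟨bigτ X x, bigτ_mem X x⟩
  map_add' x y := Subtype.ext (map_add (bigτ X) x y)
  map_smul' c x := Subtype.ext (map_smul (bigτ X) c x)

/-- The canonical homomorphism from `A` to `O_H`. -/
def cpπ (X : HilbertBimodule A H) : A →⋆ₙₐ[ℂ] CuntzPimsner X :=
  NonUnitalStarAlgHom.codRestrict (bigπ X) (cpSub X) (bigπ_mem X)

theorem bigGauge_mem (X : HilbertBimodule A H) (z : Circle) (c : Big X) (hc : c ∈ cpSub X) :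
    bigGauge X z c ∈ cpSub X := by
  have hcont : Continuous (bigGauge X z) :=
    AddMonoidHomClass.continuous_of_bound (bigGauge X z) 1 fun c => by
      simpa using NonUnitalStarAlgHom.norm_apply_le (bigGauge X z) c
  have hle : NonUnitalStarAlgebra.adjoin ℂ (Set.range (bigτ X) ∪ Set.range (bigπ X)) ≤
      (cpSub X).comap (bigGauge X z) := by
    refine NonUnitalStarAlgebra.adjoin_le ?_
    rintro _ (⟨x, rfl⟩ | ⟨a, rfl⟩)
    · exact SMulMemClass.smul_mem (z : ℂ) (bigτ_mem X x)
    · exact bigπ_mem X a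
  exact NonUnitalStarSubalgebra.topologicalClosure_minimal _ hle
    ((NonUnitalStarSubalgebra.isClosed_topologicalClosure _).preimage hcont) hc

/-- The gauge action of the circle on `O_H`. -/
def gauge (X : HilbertBimodule A H) (z : Circle) : CuntzPimsner X →⋆ₙₐ[ℂ] CuntzPimsner X :=
  NonUnitalStarAlgHom.codRestrict
    ((bigGauge X z).comp (NonUnitalStarSubalgebraClass.subtype (cpSub X))) (cpSub X)
    fun c => bigGauge_mem X z c c.2

/-- The core `F_H` of `O_H`: the fixed point algebra of the gauge action. -/
def core (X : HilbertBimodule A H) : NonUnitalStarSubalgebra ℂ (CuntzPimsner X) where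
  carrier := {c | ∀ z : Circle, gauge X z c = c}
  zero_mem' z := map_zero _
  add_mem' hc hd z := by rw [map_add, hc z, hd z]
  mul_mem' hc hd z := by rw [map_mul, hc z, hd z]
  smul_mem' r c hc z := by rw [map_smul, hc z]
  star_mem' hc z := by rw [map_star, hc z]

theorem gauge_cpτ (X : HilbertBimodule A H) (z : Circle) (x : H) :
    gauge X z (cpτ X x) = (z : ℂ) • cpτ X x := rfl

theorem gauge_cpπ (X : HilbertBimodule A H) (z : Circle) (a : A) :
    gauge X z (cpπ X a) = cpπ X a := rfl

/-- Homomorphisms out of `O_H` that agree on the generators are equal. -/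
theorem cuntzPimsner_hom_ext {X : HilbertBimodule A H} {C : Type w} [NonUnitalCStarAlgebra C]
    {ρ ρ' : CuntzPimsner X →⋆ₙₐ[ℂ] C} (hτ : ∀ x, ρ' (cpτ X x) = ρ (cpτ X x))
    (hπ : ∀ a, ρ' (cpπ X a) = ρ (cpπ X a)) : ρ' = ρ := by
  have hc : ∀ σ : CuntzPimsner X →⋆ₙₐ[ℂ] C, Continuous σ := fun σ =>
    AddMonoidHomClass.continuous_of_bound σ 1 fun c => by
      simpa using NonUnitalStarAlgHom.norm_apply_le σ c
  have key : ∀ c (hc : c ∈ NonUnitalStarAlgebra.adjoin ℂ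
      (Set.range (bigτ X) ∪ Set.range (bigπ X))),
      ρ' ⟨c, NonUnitalStarSubalgebra.le_topologicalClosure _ hc⟩ =
        ρ ⟨c, NonUnitalStarSubalgebra.le_topologicalClosure _ hc⟩ := by
    intro c hc
    induction hc using NonUnitalStarAlgebra.adjoin_induction with
    | mem c hc =>
      rcases hc with ⟨x, rfl⟩ | ⟨a, rfl⟩
      · exact hτ x
      · exact hπ a
    | add c d hc hd ihc ihd =>
      exact (map_add ρ' _ _).trans ((congrArg₂ (· + ·) ihc ihd).trans (map_add ρ _ _).symm)
    | zero => exact (map_zero ρ').trans (map_zero ρ).symm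
    | mul c d hc hd ihc ihd =>
      exact (map_mul ρ' _ _).trans ((congrArg₂ (· * ·) ihc ihd).trans (map_mul ρ _ _).symm)
    | smul r c hc ih =>
      exact (map_smul ρ' r _).trans ((congrArg (r • ·) ih).trans (map_smul ρ r _).symm)
    | star c hc ih =>
      exact (map_star ρ' _).trans ((congrArg star ih).trans (map_star ρ _).symm)
  ext ⟨c, hcl⟩
  have himg : (Subtype.val : CuntzPimsner X → Big X) '' (Subtype.val ⁻¹'
      (NonUnitalStarAlgebra.adjoin ℂ
        (Set.range (bigτ X) ∪ Set.range (bigπ X)) : Set (Big X))) =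
      (NonUnitalStarAlgebra.adjoin ℂ
        (Set.range (bigτ X) ∪ Set.range (bigπ X)) : Set (Big X)) :=
    Set.image_preimage_eq_of_subset fun d hd =>
      ⟨⟨d, NonUnitalStarSubalgebra.le_topologicalClosure _ hd⟩, rfl⟩
  have hcl' : (⟨c, hcl⟩ : CuntzPimsner X) ∈ closure (Subtype.val ⁻¹'
      (NonUnitalStarAlgebra.adjoin ℂ
        (Set.range (bigτ X) ∪ Set.range (bigπ X)) : Set (Big X))) := by
    rw [closure_subtype, himg]
    exact hcl
  refine closure_minimal (t := {d | ρ' d = ρ d}) ?_ (isClosed_eq (hc ρ') (hc ρ)) hcl'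
  rintro ⟨d, hd'⟩ hd
  exact key d hd

theorem cp_isToeplitz (X : HilbertBimodule A H) : IsToeplitz X (cpτ X) (cpπ X) where
  map_right x a := by
    apply Subtype.ext; apply Subtype.ext; funext i
    exact i.isCovariant.map_right x a
  map_inner x y := by
    apply Subtype.ext; apply Subtype.ext; funext i
    exact i.isCovariant.map_inner x y
  map_left a x := by
    apply Subtype.ext; apply Subtype.ext; funext i
    exact i.isCovariant.map_left a x

/-- The universal property of `O_H`. -/
theorem cuntzPimsner_universal (X : HilbertBimodule A H) {C : Type (max u v)}
    [NonUnitalCStarAlgebra C] (τ : H →ₗ[ℂ] C) (π : A →⋆ₙₐ[ℂ] C) (h : IsCovariant X τ π) :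
    ∃! ρ : CuntzPimsner X →⋆ₙₐ[ℂ] C,
      (∀ x, ρ (cpτ X x) = τ x) ∧ ∀ a, ρ (cpπ X a) = π a := by
  let i : CovRep X := { C := C, τ := τ, π := π, isCovariant := h }
  let ρ : CuntzPimsner X →⋆ₙₐ[ℂ] C :=
    { toFun := fun c => (c : Big X) i
      map_smul' := fun _ _ => rfl
      map_zero' := rfl
      map_add' := fun _ _ => rfl
      map_mul' := fun _ _ => rfl
      map_star' := fun _ => rfl }
  exact ⟨ρ, ⟨fun _ => rfl, fun _ => rfl⟩, fun ρ' h' => cuntzPimsner_hom_ext h'.1 h'.2⟩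

theorem gauge_one (X : HilbertBimodule A H) :
    gauge X 1 = NonUnitalStarAlgHom.id ℂ (CuntzPimsner X) :=
  cuntzPimsner_hom_ext (fun x => by simp [gauge_cpτ]) fun a => by simp [gauge_cpπ]

theorem gauge_mul (X : HilbertBimodule A H) (z w : Circle) :
    gauge X (z * w) = (gauge X z).comp (gauge X w) :=
  cuntzPimsner_hom_ext
    (fun x => by
      rw [NonUnitalStarAlgHom.comp_apply, gauge_cpτ, gauge_cpτ, map_smul, gauge_cpτ, smul_smul,
        Circle.coe_mul, mul_comm])
    fun a => by simp [gauge_cpπ]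

/-- For a word `α = α₁ ⋯ α_k`, the product `S_α c = S_{α₁} ⋯ S_{α_k} c` with `S_i = S_{ξ i}`; for
the empty word it is `c`. -/
def wordMul (X : HilbertBimodule A H) {n : ℕ} (ξ : Fin n → H) (α : List (Fin n))
    (c : CuntzPimsner X) : CuntzPimsner X :=
  α.foldr (fun i d => cpτ X (ξ i) * d) c

/-- The monomial `S_α a S_β^*`, written as `S_α (S_β a^*)^*`. -/
def monomial (X : HilbertBimodule A H) {n : ℕ} (ξ : Fin n → H) (α : List (Fin n)) (a : A)
    (β : List (Fin n)) : CuntzPimsner X :=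
  wordMul X ξ α (star (wordMul X ξ β (star (cpπ X a))))

end Rep

end CP

/-!
The argument is elementary and rests on two identities available from a finite basis.

For `K(H) = L(H)`: an operator `T` commuting with the right action of `A` satisfies
`T = ∑ i, θ_{T ξ i, ξ i}` (`eq_sum_rankOne`). Adjointable operators commute with the right action, and
the operators which do so form a closed subspace, so the space of such operators is equal to both
`K(H)` and `L(H)`.

For `O_H`: applying `τ` to the basis expansion gives `τ x = ∑ i, S_i ⟨ξ i, x⟩`
(`cpτ_eq_sum`). With `a S_j = τ (φ(a) ξ_j)` it moves coefficients to the right past a word, and with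
`S_i^* S_j = ⟨ξ i, ξ j⟩` it shows that the linear span of the monomials `S_α a S_β^*` is stable under
left multiplication by the generators and their adjoints. Hence that span is the whole
`*`-algebra generated by `H` and `A`, which is dense.

For the core, the gauge action multiplies `S_α a S_β^*` by `z ^ |α| * conj z ^ |β|`. Averaging the
gauge action over the `m`-th roots of unity is a contraction which fixes the core, and for large `m`
it maps a given linear combination of monomials to its part with `|α| = |β|`
(`exists_gaugeMean_mem`); this finite average replaces the integral over the circle. So elements
of the core are limits of combinations of monomials with `|α| = |β|`.
-/

namespace CP

/-! ### Operators on a module with a finite basis -/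

section Module

variable {A : Type u} {H : Type v} [NonUnitalCStarAlgebra A] [PartialOrder A]
  [NormedAddCommGroup H] [NormedSpace ℂ H] [SMul Aᵐᵒᵖ H] [CStarModule Aᵐᵒᵖ H]

theorem add_op_smul (a : A) (x y : H) :
    MulOpposite.op a • (x + y) = MulOpposite.op a • x + MulOpposite.op a • y :=
  rinner_ext A fun t => by simp only [rinner_op_smul_right, rinner_add_right, add_mul]

theorem complex_smul_op_smul (a : A) (c : ℂ) (x : H) :
    MulOpposite.op a • (c • x) = c • MulOpposite.op a • x :=
  rinner_ext A fun t => by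
    simp only [rinner_op_smul_right, rinner_smul_right, smul_mul_assoc]

theorem continuous_op_smul (a : A) : Continuous fun x : H => MulOpposite.op a • x := by
  let f : H →+ H := AddMonoidHom.mk' (fun x => MulOpposite.op a • x) (add_op_smul a)
  refine AddMonoidHomClass.continuous_of_bound f ‖a‖ fun x => ?_
  rw [mul_comm]
  exact norm_op_smul_le A x a

variable (A) in
/-- The bounded operators on `H` that commute with the right action of `A`. -/
def rightLinear (H : Type v) [NormedAddCommGroup H] [NormedSpace ℂ H] [SMul Aᵐᵒᵖ H]
    [CStarModule Aᵐᵒᵖ H] : Submodule ℂ (H →L[ℂ] H) where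
  carrier := {T | ∀ (a : A) (x : H), T (MulOpposite.op a • x) = MulOpposite.op a • T x}
  zero_mem' a x := by
    refine rinner_ext A fun t => ?_
    have h0 : rinner A t (0 : H) = 0 := by simp [rinner]
    simp [rinner_op_smul_right, h0]
  add_mem' hS hT a x := by simp [hS a x, hT a x, add_op_smul]
  smul_mem' c T hT a x := by simp [hT a x, complex_smul_op_smul]

theorem isClosed_rightLinear : IsClosed (rightLinear A H : Set (H →L[ℂ] H)) := by
  have h : (rightLinear A H : Set (H →L[ℂ] H)) =
      ⋂ (a : A) (x : H), {T | T (MulOpposite.op a • x) = MulOpposite.op a • T x} := by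
    ext T
    simp [rightLinear]
  rw [h]
  refine isClosed_iInter fun a => isClosed_iInter fun x => isClosed_eq ?_ ?_
  · exact (ContinuousLinearMap.apply ℂ H (MulOpposite.op a • x)).continuous
  · exact (continuous_op_smul a).comp (ContinuousLinearMap.apply ℂ H x).continuous

theorem adjointable_le_rightLinear :
    Subalgebra.toSubmodule (adjointable A H) ≤ rightLinear A H := by
  rintro T ⟨S, hS⟩ a x
  have hS' : ∀ t y, rinner A t (T y) = rinner A (S t) y := fun t y => by
    rw [← star_rinner, hS, star_rinner]
  exact rinner_ext A fun t => by rw [hS', rinner_op_smul_right, rinner_op_smul_right, hS']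

variable [StarOrderedRing A]

theorem rankOne_apply (x y z : H) : rankOne A x y z = MulOpposite.op (rinner A y z) • x := rfl

theorem rankOne_mem_adjointable (x y : H) : rankOne A x y ∈ adjointable A H :=
  ⟨rankOne A y x, fun z w => by
    rw [rankOne_apply, rankOne_apply, rinner_op_smul_right, ← star_rinner, rinner_op_smul_right,
      star_mul, star_rinner, star_rinner]⟩

theorem eq_sum_rankOne {n : ℕ} {ξ : Fin n → H} (hξ : IsBasis A ξ) {T : H →L[ℂ] H}
    (hT : T ∈ rightLinear A H) : T = ∑ i, rankOne A (T (ξ i)) (ξ i) := by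
  ext x
  conv_lhs => rw [hξ x, map_sum]
  simp only [sum_apply, rankOne_apply]
  exact Finset.sum_congr rfl fun i _ => hT _ _

theorem compacts_eq_adjointable {n : ℕ} {ξ : Fin n → H} (hξ : IsBasis A ξ) :
    compacts A H = Subalgebra.toSubmodule (adjointable A H) := by
  apply le_antisymm
  · intro T hT
    have hle : compacts A H ≤ rightLinear A H := by
      refine Submodule.topologicalClosure_minimal _ (Submodule.span_le.mpr ?_) isClosed_rightLinear
      rintro _ ⟨x, y, rfl⟩
      exact adjointable_le_rightLinear (rankOne_mem_adjointable x y)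
    rw [eq_sum_rankOne hξ (hle hT)]
    exact Submodule.sum_mem _ fun i _ => rankOne_mem_adjointable _ _
  · intro T hT
    rw [eq_sum_rankOne hξ (adjointable_le_rightLinear hT)]
    exact Submodule.sum_mem _ fun i _ => rankOne_mem_compacts A _ _

end Module

/-! ### The span of the monomials -/

section Rep

variable {A : Type u} {H : Type v} [NonUnitalCStarAlgebra A] [PartialOrder A] [StarOrderedRing A]
  [NormedAddCommGroup H] [NormedSpace ℂ H] [SMul Aᵐᵒᵖ H] [CStarModule Aᵐᵒᵖ H]
  (X : HilbertBimodule A H) {n : ℕ} (ξ : Fin n → H)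

theorem wordMul_nil (c : CuntzPimsner X) : wordMul X ξ [] c = c := rfl

theorem wordMul_cons (i : Fin n) (α : List (Fin n)) (c : CuntzPimsner X) :
    wordMul X ξ (i :: α) c = cpτ X (ξ i) * wordMul X ξ α c := rfl

theorem wordMul_append (α β : List (Fin n)) (c : CuntzPimsner X) :
    wordMul X ξ (α ++ β) c = wordMul X ξ α (wordMul X ξ β c) :=
  List.foldr_append ..

theorem wordMul_mul (α : List (Fin n)) (c d : CuntzPimsner X) :
    wordMul X ξ α (c * d) = wordMul X ξ α c * d := by
  induction α with
  | nil => rfl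
  | cons i α ih => rw [wordMul_cons, wordMul_cons, ih, mul_assoc]

theorem wordMul_sum {ι : Type*} (s : Finset ι) (α : List (Fin n)) (c : ι → CuntzPimsner X) :
    wordMul X ξ α (∑ j ∈ s, c j) = ∑ j ∈ s, wordMul X ξ α (c j) := by
  induction α with
  | nil => rfl
  | cons i α ih => simp only [wordMul_cons, ih, Finset.mul_sum]

theorem wordMul_smul (α : List (Fin n)) (r : ℂ) (c : CuntzPimsner X) :
    wordMul X ξ α (r • c) = r • wordMul X ξ α c := by
  induction α with
  | nil => rfl
  | cons i α ih => rw [wordMul_cons, wordMul_cons, ih, mul_smul_comm]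

/-- `(S_α c^* S_β^*)^* = S_β c S_α^*`. -/
theorem star_wordMul_star_wordMul (α β : List (Fin n)) (c : CuntzPimsner X) :
    star (wordMul X ξ α (star (wordMul X ξ β c))) =
      wordMul X ξ β (star (wordMul X ξ α (star c))) := by
  induction α with
  | nil => rw [wordMul_nil, wordMul_nil, star_star, star_star]
  | cons i α ih => rw [wordMul_cons, wordMul_cons, star_mul, star_mul, ih, wordMul_mul]

theorem star_monomial (α β : List (Fin n)) (a : A) :
    star (monomial X ξ α a β) = monomial X ξ β (star a) α := by
  rw [monomial, monomial, star_wordMul_star_wordMul, map_star]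

/-- The linear span of the monomials `S_α a S_β^*`. -/
def monomialSpan : Submodule ℂ (CuntzPimsner X) :=
  Submodule.span ℂ {c | ∃ (α β : List (Fin n)) (a : A), c = monomial X ξ α a β}

/-- The linear span of the monomials `S_α a S_β^*` with `|α| = |β|`. -/
def balancedSpan : Submodule ℂ (CuntzPimsner X) :=
  Submodule.span ℂ {c | ∃ (α β : List (Fin n)) (a : A),
    α.length = β.length ∧ c = monomial X ξ α a β}

variable {ξ}

theorem monomial_mem (α β : List (Fin n)) (a : A) : monomial X ξ α a β ∈ monomialSpan X ξ :=
  Submodule.subset_span ⟨α, β, a, rfl⟩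

/-- It is enough to check on monomials that left multiplication by `c` preserves their span. -/
theorem mul_mem_of_forall_monomial {c : CuntzPimsner X}
    (h : ∀ α β a, c * monomial X ξ α a β ∈ monomialSpan X ξ) {d : CuntzPimsner X}
    (hd : d ∈ monomialSpan X ξ) : c * d ∈ monomialSpan X ξ := by
  have hle : monomialSpan X ξ ≤ (monomialSpan X ξ).comap (LinearMap.mulLeft ℂ c) :=
    Submodule.span_le.mpr (by rintro _ ⟨α, β, a, rfl⟩; exact h α β a)
  exact hle hd

theorem star_mem_monomialSpan {d : CuntzPimsner X} (hd : d ∈ monomialSpan X ξ) :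
    star d ∈ monomialSpan X ξ := by
  induction hd using Submodule.span_induction with
  | mem d hd =>
    obtain ⟨α, β, a, rfl⟩ := hd
    rw [star_monomial]
    exact monomial_mem X β α (star a)
  | zero => rw [star_zero]; exact Submodule.zero_mem _
  | add c d _ _ hc hd => rw [star_add]; exact Submodule.add_mem _ hc hd
  | smul r c _ hc => rw [star_smul]; exact Submodule.smul_mem _ _ hc

theorem cpπ_mem_monomialSpan (a : A) : cpπ X a ∈ monomialSpan X ξ := by
  have h := monomial_mem X (ξ := ξ) [] [] a
  rwa [monomial, wordMul_nil, wordMul_nil, star_star] at h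

theorem basis_mul_mem (i : Fin n) {d : CuntzPimsner X} (hd : d ∈ monomialSpan X ξ) :
    cpτ X (ξ i) * d ∈ monomialSpan X ξ :=
  mul_mem_of_forall_monomial X (fun α β a => monomial_mem X (i :: α) β a) hd

theorem cpτ_eq_sum (hξ : IsBasis A ξ) (x : H) :
    cpτ X x = ∑ i, cpτ X (ξ i) * cpπ X (rinner A (ξ i) x) := by
  conv_lhs => rw [hξ x, map_sum]
  exact Finset.sum_congr rfl fun i _ => (cp_isToeplitz X).map_right _ _

theorem cpτ_mul_mem_of_cpπ_mul_mem (hξ : IsBasis A ξ) (x : H) {d : CuntzPimsner X}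
    (h : ∀ a, cpπ X a * d ∈ monomialSpan X ξ) : cpτ X x * d ∈ monomialSpan X ξ := by
  rw [cpτ_eq_sum X hξ x, Finset.sum_mul]
  refine Submodule.sum_mem _ fun i _ => ?_
  rw [mul_assoc]
  exact basis_mul_mem X i (h _)

theorem cpπ_mul_mem (hξ : IsBasis A ξ) (a : A) {d : CuntzPimsner X}
    (hd : d ∈ monomialSpan X ξ) : cpπ X a * d ∈ monomialSpan X ξ := by
  refine mul_mem_of_forall_monomial X (fun α β b => ?_) hd
  induction α generalizing a with
  | nil =>
    have h : cpπ X a * monomial X ξ [] b β = monomial X ξ [] (a * b) β := by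
      rw [monomial, monomial, wordMul_nil, wordMul_nil, map_mul, star_mul, wordMul_mul, star_mul,
        star_star]
    rw [h]
    exact monomial_mem X _ _ _
  | cons j α ih =>
    have h : cpπ X a * monomial X ξ (j :: α) b β =
        cpτ X (X.φ a (ξ j)) * monomial X ξ α b β := by
      rw [monomial, wordMul_cons, ← mul_assoc, ← (cp_isToeplitz X).map_left]
      rfl
    rw [h]
    exact cpτ_mul_mem_of_cpπ_mul_mem X hξ _ ih

theorem cpτ_mul_mem (hξ : IsBasis A ξ) (x : H) {d : CuntzPimsner X}
    (hd : d ∈ monomialSpan X ξ) : cpτ X x * d ∈ monomialSpan X ξ :=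
  cpτ_mul_mem_of_cpπ_mul_mem X hξ x fun a => cpπ_mul_mem X hξ a hd

theorem star_cpτ_mul_mem (hξ : IsBasis A ξ) (x : H) {d : CuntzPimsner X}
    (hd : d ∈ monomialSpan X ξ) : star (cpτ X x) * d ∈ monomialSpan X ξ := by
  refine mul_mem_of_forall_monomial X (fun α β b => ?_) hd
  cases α with
  | nil =>
    -- Pass to adjoints: `S_β b^* τ(x) = S_β τ(φ(b^*) x)`, and expand the last factor in the basis.
    have h : star (star (cpτ X x) * monomial X ξ [] b β) =
        ∑ i, monomial X ξ (β ++ [i]) (rinner A (ξ i) (X.φ (star b) x)) [] := by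
      rw [star_mul, star_star, star_monomial, monomial, wordMul_nil, star_star, ← wordMul_mul,
        ← (cp_isToeplitz X).map_left, cpτ_eq_sum X hξ, wordMul_sum]
      refine Finset.sum_congr rfl fun i _ => ?_
      rw [monomial, wordMul_nil, star_star, wordMul_append, wordMul_cons, wordMul_nil]
    rw [← star_star (star (cpτ X x) * monomial X ξ [] b β), h]
    exact star_mem_monomialSpan X (Submodule.sum_mem _ fun i _ => monomial_mem X _ _ _)
  | cons j α =>
    have h : star (cpτ X x) * monomial X ξ (j :: α) b β =
        cpπ X (rinner A x (ξ j)) * monomial X ξ α b β := by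
      rw [monomial, wordMul_cons, ← mul_assoc, (cp_isToeplitz X).map_inner]
      rfl
    rw [h]
    exact cpπ_mul_mem X hξ _ (monomial_mem X _ _ _)

/-- The `*`-algebra generated by `H` and `A`, which is dense in `O_H` by construction, lies in the
span of the monomials. -/
theorem exists_mem_monomialSpan (hξ : IsBasis A ξ) {c : Big X}
    (hc : c ∈ NonUnitalStarAlgebra.adjoin ℂ (Set.range (bigτ X) ∪ Set.range (bigπ X))) :
    ∃ d ∈ monomialSpan X ξ, (d : Big X) = c := by
  -- Stability of the span under left multiplication by `d` and `d^*` passes to sums, products and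
  -- adjoints; as `O_H` need not be unital, membership of `d` itself is carried along.
  suffices h : ∃ d : CuntzPimsner X, (d : Big X) = c ∧ d ∈ monomialSpan X ξ ∧
      (∀ e ∈ monomialSpan X ξ, d * e ∈ monomialSpan X ξ) ∧
      ∀ e ∈ monomialSpan X ξ, star d * e ∈ monomialSpan X ξ by
    obtain ⟨d, h1, h2, -⟩ := h
    exact ⟨d, h2, h1⟩
  induction hc using NonUnitalStarAlgebra.adjoin_induction with
  | mem c hc =>
    rcases hc with ⟨x, rfl⟩ | ⟨a, rfl⟩
    · refine ⟨cpτ X x, rfl, ?_, fun e he => cpτ_mul_mem X hξ x he,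
        fun e he => star_cpτ_mul_mem X hξ x he⟩
      rw [cpτ_eq_sum X hξ x]
      exact Submodule.sum_mem _ fun i _ => basis_mul_mem X i (cpπ_mem_monomialSpan X _)
    · refine ⟨cpπ X a, rfl, cpπ_mem_monomialSpan X a, fun e he => cpπ_mul_mem X hξ a he,
        fun e he => ?_⟩
      rw [← map_star]
      exact cpπ_mul_mem X hξ _ he
  | add c c' _ _ ih ih' =>
    obtain ⟨d, rfl, h1, h2, h3⟩ := ih
    obtain ⟨d', rfl, h1', h2', h3'⟩ := ih'
    refine ⟨d + d', rfl, Submodule.add_mem _ h1 h1', fun e he => ?_, fun e he => ?_⟩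
    · rw [add_mul]
      exact Submodule.add_mem _ (h2 e he) (h2' e he)
    · rw [star_add, add_mul]
      exact Submodule.add_mem _ (h3 e he) (h3' e he)
  | zero =>
    refine ⟨0, rfl, Submodule.zero_mem _, fun e _ => ?_, fun e _ => ?_⟩
    · rw [zero_mul]
      exact Submodule.zero_mem _
    · rw [star_zero, zero_mul]
      exact Submodule.zero_mem _
  | mul c c' _ _ ih ih' =>
    obtain ⟨d, rfl, h1, h2, h3⟩ := ih
    obtain ⟨d', rfl, h1', h2', h3'⟩ := ih'
    refine ⟨d * d', rfl, h2 _ h1', fun e he => ?_, fun e he => ?_⟩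
    · rw [mul_assoc]
      exact h2 _ (h2' e he)
    · rw [star_mul, mul_assoc]
      exact h3' _ (h3 e he)
  | smul r c _ ih =>
    obtain ⟨d, rfl, h1, h2, h3⟩ := ih
    refine ⟨r • d, rfl, Submodule.smul_mem _ r h1, fun e he => ?_, fun e he => ?_⟩
    · rw [smul_mul_assoc]
      exact Submodule.smul_mem _ r (h2 e he)
    · rw [star_smul, smul_mul_assoc]
      exact Submodule.smul_mem _ _ (h3 e he)
  | star c _ ih =>
    obtain ⟨d, rfl, h1, h2, h3⟩ := ih
    refine ⟨star d, rfl, star_mem_monomialSpan X h1, h3, fun e he => ?_⟩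
    rw [star_star]
    exact h2 e he

theorem dense_monomialSpan (hξ : IsBasis A ξ) :
    (monomialSpan X ξ).topologicalClosure = ⊤ := by
  rw [eq_top_iff]
  rintro c -
  rw [← SetLike.mem_coe, Submodule.topologicalClosure_coe, closure_subtype]
  refine closure_mono ?_ c.2
  intro d hd
  obtain ⟨e, he, rfl⟩ := exists_mem_monomialSpan X hξ hd
  exact ⟨e, he, rfl⟩

/-! ### Averaging the gauge action over roots of unity -/

theorem norm_gauge_le (z : Circle) (c : CuntzPimsner X) : ‖gauge X z c‖ ≤ ‖c‖ :=
  NonUnitalStarAlgHom.norm_apply_le (gauge X z) c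

theorem continuous_gauge (z : Circle) : Continuous (gauge X z) :=
  AddMonoidHomClass.continuous_of_bound (gauge X z) 1 fun c => by
    simpa using norm_gauge_le X z c

theorem gauge_wordMul (z : Circle) (α : List (Fin n)) (c : CuntzPimsner X) :
    gauge X z (wordMul X ξ α c) = (z : ℂ) ^ α.length • wordMul X ξ α (gauge X z c) := by
  induction α with
  | nil => simp [wordMul_nil]
  | cons i α ih =>
    rw [wordMul_cons, wordMul_cons, map_mul, gauge_cpτ, ih, smul_mul_smul_comm,
      List.length_cons, pow_succ']

theorem gauge_monomial (z : Circle) (α β : List (Fin n)) (a : A) :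
    gauge X z (monomial X ξ α a β) =
      ((z : ℂ) ^ α.length * star (z : ℂ) ^ β.length) • monomial X ξ α a β := by
  rw [monomial, gauge_wordMul, map_star, gauge_wordMul, map_star, gauge_cpπ, star_smul,
    wordMul_smul, smul_smul, star_pow]

theorem star_coe_mul_coe (z : Circle) : star (z : ℂ) * (z : ℂ) = 1 := by
  rw [mul_comm]
  change (z : ℂ) * (starRingEnd ℂ) (z : ℂ) = 1
  rw [Complex.mul_conj, Circle.normSq_coe, Complex.ofReal_one]

theorem monomial_mem_core {α β : List (Fin n)} (h : α.length = β.length) (a : A) :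
    monomial X ξ α a β ∈ core X := by
  intro z
  rw [gauge_monomial, h, ← mul_pow, mul_comm (z : ℂ), star_coe_mul_coe, one_pow, one_smul]

theorem isClosed_core : IsClosed ((core X).toSubmodule : Set (CuntzPimsner X)) := by
  have h : ((core X).toSubmodule : Set (CuntzPimsner X)) = ⋂ z : Circle, {c | gauge X z c = c} := by
    ext c
    rw [Set.mem_iInter]
    rfl
  rw [h]
  exact isClosed_iInter fun z => isClosed_eq (continuous_gauge X z) continuous_id

/-- The point `exp (2πi / m)` of the circle. -/
def rootOfUnity (m : ℕ) : Circle := Circle.exp (2 * Real.pi / m)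

theorem isPrimitiveRoot_rootOfUnity {m : ℕ} (hm : m ≠ 0) :
    IsPrimitiveRoot (rootOfUnity m : ℂ) m := by
  have h := Complex.isPrimitiveRoot_exp m hm
  rw [rootOfUnity, Circle.coe_exp]
  convert h using 2
  push_cast
  ring

/-- The mean of `gauge X z` over the `m`-th roots of unity `z`. -/
def gaugeMean (m : ℕ) : CuntzPimsner X →ₗ[ℂ] CuntzPimsner X where
  toFun c := (m : ℂ)⁻¹ • ∑ j ∈ Finset.range m, gauge X (rootOfUnity m ^ j) c
  map_add' c d := by simp only [map_add, Finset.sum_add_distrib, smul_add]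
  map_smul' r c := by
    simp only [map_smul, ← Finset.smul_sum, smul_comm r, RingHom.id_apply]

theorem gaugeMean_apply (m : ℕ) (c : CuntzPimsner X) :
    gaugeMean X m c = (m : ℂ)⁻¹ • ∑ j ∈ Finset.range m, gauge X (rootOfUnity m ^ j) c := rfl

theorem norm_gaugeMean_le {m : ℕ} (hm : m ≠ 0) (c : CuntzPimsner X) :
    ‖gaugeMean X m c‖ ≤ ‖c‖ := by
  have h : ‖∑ j ∈ Finset.range m, gauge X (rootOfUnity m ^ j) c‖ ≤ m * ‖c‖ := by
    refine (norm_sum_le_of_le _ fun j _ => norm_gauge_le X _ c).trans ?_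
    simp
  rw [gaugeMean_apply, norm_smul, norm_inv, Complex.norm_natCast]
  calc (m : ℝ)⁻¹ * _ ≤ (m : ℝ)⁻¹ * (m * ‖c‖) := by gcongr
    _ = ‖c‖ := inv_mul_cancel_left₀ (Nat.cast_ne_zero.mpr hm) _

theorem gaugeMean_of_mem_core {m : ℕ} (hm : m ≠ 0) {c : CuntzPimsner X} (hc : c ∈ core X) :
    gaugeMean X m c = c := by
  rw [gaugeMean_apply, Finset.sum_congr rfl fun j _ => hc _, Finset.sum_const,
    Finset.card_range, ← Nat.cast_smul_eq_nsmul ℂ, smul_smul,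
    inv_mul_cancel₀ (Nat.cast_ne_zero.mpr hm), one_smul]

theorem gaugeMean_monomial_eq_zero {m : ℕ} {α β : List (Fin n)} (hα : α.length < m)
    (hβ : β.length < m) (hαβ : α.length ≠ β.length) (a : A) :
    gaugeMean X m (monomial X ξ α a β) = 0 := by
  set ζ : ℂ := (rootOfUnity m : ℂ) with hζ
  have hprim : IsPrimitiveRoot ζ m := isPrimitiveRoot_rootOfUnity (by omega)
  have hstar : star ζ * ζ = 1 := star_coe_mul_coe _
  set w : ℂ := ζ ^ α.length * star ζ ^ β.length with hw
  have hw1 : w ≠ 1 := by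
    intro h
    refine hαβ (hprim.pow_inj hα hβ ?_)
    calc ζ ^ α.length = ζ ^ α.length * (star ζ * ζ) ^ β.length := by rw [hstar]; simp
      _ = w * ζ ^ β.length := by rw [hw, mul_pow]; ring
      _ = ζ ^ β.length := by rw [h, one_mul]
  have hwm : w ^ m = 1 := by
    rw [hw, mul_pow, ← pow_mul, ← pow_mul, mul_comm _ m, mul_comm _ m, pow_mul, pow_mul,
      ← star_pow, hprim.pow_eq_one]
    simp
  have hsum : ∑ j ∈ Finset.range m, w ^ j = 0 := by
    have h := geom_sum_mul w m
    rw [hwm, sub_self] at h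
    exact (mul_eq_zero.mp h).resolve_right (sub_ne_zero.mpr hw1)
  have hj : ∀ j ∈ Finset.range m, gauge X (rootOfUnity m ^ j) (monomial X ξ α a β) =
      w ^ j • monomial X ξ α a β := fun j _ => by
    rw [gauge_monomial, Circle.coe_pow, ← hζ, hw]
    congr 1
    rw [star_pow]
    ring
  rw [gaugeMean_apply, Finset.sum_congr rfl hj, ← Finset.sum_smul, hsum, zero_smul, smul_zero]

theorem exists_gaugeMean_mem {d : CuntzPimsner X} (hd : d ∈ monomialSpan X ξ) :
    ∃ N : ℕ, ∀ m > N, gaugeMean X m d ∈ balancedSpan X ξ := by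
  induction hd using Submodule.span_induction with
  | mem d hd =>
    obtain ⟨α, β, a, rfl⟩ := hd
    refine ⟨α.length + β.length, fun m hm => ?_⟩
    by_cases h : α.length = β.length
    · rw [gaugeMean_of_mem_core X (by omega) (monomial_mem_core X h a)]
      exact Submodule.subset_span ⟨α, β, a, h, rfl⟩
    · rw [gaugeMean_monomial_eq_zero X (by omega) (by omega) h]
      exact Submodule.zero_mem _
  | zero => exact ⟨0, fun m _ => by rw [map_zero]; exact Submodule.zero_mem _⟩
  | add c d _ _ hc hd =>
    obtain ⟨N, hN⟩ := hc
    obtain ⟨N', hN'⟩ := hd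
    refine ⟨max N N', fun m hm => ?_⟩
    rw [map_add]
    exact Submodule.add_mem _ (hN m (by omega)) (hN' m (by omega))
  | smul r c _ hc =>
    obtain ⟨N, hN⟩ := hc
    exact ⟨N, fun m hm => by rw [map_smul]; exact Submodule.smul_mem _ r (hN m hm)⟩

theorem closure_balancedSpan (hξ : IsBasis A ξ) :
    (balancedSpan X ξ).topologicalClosure = (core X).toSubmodule := by
  apply le_antisymm
  · refine Submodule.topologicalClosure_minimal _ (Submodule.span_le.mpr ?_) (isClosed_core X)
    rintro _ ⟨α, β, a, h, rfl⟩
    exact monomial_mem_core X h a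
  · intro c hc
    rw [← SetLike.mem_coe, Submodule.topologicalClosure_coe, Metric.mem_closure_iff]
    intro ε hε
    have hcl : c ∈ closure (monomialSpan X ξ : Set (CuntzPimsner X)) := by
      rw [← Submodule.topologicalClosure_coe, dense_monomialSpan X hξ]
      exact Submodule.mem_top
    obtain ⟨d, hd, hcd⟩ := Metric.mem_closure_iff.mp hcl ε hε
    obtain ⟨N, hN⟩ := exists_gaugeMean_mem X hd
    refine ⟨gaugeMean X (N + 1) d, hN _ (Nat.lt_succ_self N), ?_⟩
    -- The mean fixes `c` and is contractive, so it maps `d` no farther from `c`.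
    rw [dist_eq_norm] at hcd ⊢
    rw [← gaugeMean_of_mem_core X (Nat.succ_ne_zero N) hc, ← map_sub]
    exact (norm_gaugeMean_le X (Nat.succ_ne_zero N) _).trans_lt hcd

end Rep

end CP

theorem lemma3p1 {A : Type u} {H : Type v} [NonUnitalCStarAlgebra A] [PartialOrder A]
    [StarOrderedRing A] [NormedAddCommGroup H] [NormedSpace ℂ H] [CompleteSpace H]
    [SMul Aᵐᵒᵖ H] [CStarModule Aᵐᵒᵖ H] (X : CP.HilbertBimodule A H)
    (hfull : CP.IsFull A H) {n : ℕ} (ξ : Fin n → H) (hξ : CP.IsBasis A ξ) :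
    CP.compacts A H = Subalgebra.toSubmodule (CP.adjointable A H) ∧
    (Submodule.span ℂ {c : CP.CuntzPimsner X | ∃ (α β : List (Fin n)) (a : A),
      c = CP.monomial X ξ α a β}).topologicalClosure = ⊤ ∧
    (Submodule.span ℂ {c : CP.CuntzPimsner X | ∃ (α β : List (Fin n)) (a : A),
      α.length = β.length ∧ c = CP.monomial X ξ α a β}).topologicalClosure =
        (CP.core X).toSubmodule :=
  ⟨CP.compacts_eq_adjointable hξ, CP.dense_monomialSpan X hξ, CP.closure_balancedSpan X hξ⟩
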